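/- Let $p$ be a prime number and let $S$ be a subset of $\mathbb{Z}_{2p}$ such that $-S = S$ and $0 \notin S$. Let $X = \operatorname{Cay}(\mathbb{Z}_{2p}, S)$ be the corresponding circulant graph of order $2p$: its vertices are the elements of $\mathbb{Z}_{2p}$, and $v$ is adjacent to $w$ if and only if $w = v + s$ for some $s \in S$. Let $BX$ be the canonical bipartite double cover of $X$, that is, the graph with vertex set $V(X) \times \{0,1\}$ whose edges are the pairs $\{(v,0), (w,1)\}$ with $v$ adjacent to $w$ in $X$. The group $\operatorname{Aut} X \times S_2$ is regarded as a subgroup of $\operatorname{Aut} BX$ through $(\varphi, \sigma) \cdot (v, i) = (\varphi(v), \sigma(i))$. Suppose that $X$ is nontrivially unstable, which means that $X$ is connected and not bipartite, no two distinct vertices of $X$ have exactly the same neighbours, and $X$ is unstable: $\operatorname{Aut} BX \neq \operatorname{Aut} X \times S_2$. Then $X$ has Wilson type (C.4). That is, there is a unit $m \in \mathbb{Z}_{2p}^\times$ such that $p + mS = S$ (where $p = n/2$ for $n = 2p$). -/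

import Mathlib

open scoped Pointwise

/-- The graph automorphism of the canonical double cover `BX` that is induced by an automorphism
`φ` of `X` and a permutation `σ` of the two layers (layer `false` is the set of the `Sum.inl v`,
layer `true` is the set of the `Sum.inr v`): it maps `(v, i)` to `(φ v, σ i)`. -/
def doubleCoverAut {V : Type*} (X : SimpleGraph V) (φ : X ≃g X) (σ : Equiv.Perm Bool) :
    X.bipartiteDoubleCover ≃g X.bipartiteDoubleCover where
  toEquiv := (Equiv.boolProdEquivSum V).permCongr (Equiv.prodCongr σ φ.toEquiv)
  map_rel_iff' := by
    have hσ : σ true = !(σ false) := by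
      have h : σ true ≠ σ false := fun h => by simpa using σ.injective h
      revert h
      cases σ true <;> cases σ false <;> simp
    rintro (a | a) (b | b) <;> cases h : σ false <;>
      simp [Equiv.permCongr_apply, Equiv.boolProdEquivSum, hσ, h] <;>
      exact φ.map_rel_iff

/-- The natural homomorphism `Aut X × S₂ → Aut BX` (injective if `X` has a vertex), through which
`Aut X × S₂` is a subgroup of `Aut BX`. -/
def doubleCoverAutHom {V : Type*} (X : SimpleGraph V) :
    (X ≃g X) × Equiv.Perm Bool →* (X.bipartiteDoubleCover ≃g X.bipartiteDoubleCover) where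
  toFun g := doubleCoverAut X g.1 g.2
  map_one' := by
    ext (a | a) <;> rfl
  map_mul' g h := by
    apply RelIso.ext
    intro x
    change (Equiv.boolProdEquivSum V).permCongr _ x =
      (Equiv.boolProdEquivSum V).permCongr _ ((Equiv.boolProdEquivSum V).permCongr _ x)
    simp only [Equiv.permCongr_apply, Equiv.symm_apply_apply]
    rfl

/-- `X` is unstable if the subgroup `Aut X × S₂` of `Aut BX` is proper. -/
def IsUnstable {V : Type*} (X : SimpleGraph V) : Prop :=
  (doubleCoverAutHom X).range ≠ ⊤

/-- No two distinct vertices have exactly the same neighbours. -/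
def IsTwinFree {V : Type*} (X : SimpleGraph V) : Prop :=
  ∀ v w : V, X.neighborSet v = X.neighborSet w → v = w

/-- `X` is connected, nonbipartite, twin-free and unstable. -/
def IsNontriviallyUnstable {V : Type*} (X : SimpleGraph V) : Prop :=
  X.Connected ∧ ¬ X.IsBipartite ∧ IsTwinFree X ∧ IsUnstable X

/-- The Cayley graph of `ℤ/nℤ` with connection set `S` has Wilson type (C.4) (for even `n`):
there is a unit `m` of `ℤ/nℤ` with `(n/2) + m S = S`. -/
def HasWilsonTypeC4 (n : ℕ) (S : Set (ZMod n)) : Prop :=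
  ∃ m : (ZMod n)ˣ, ((n / 2 : ℕ) : ZMod n) +ᵥ (m • S) = S

/-! ### Powers of the adjacency matrix modulo a prime -/

section Circulant

open Matrix

variable {G : Type*} [DecidableEq G]

/-! Instability yields permutations `α ≠ β` with `x - y ∈ S ↔ α x - β y ∈ S`. As `S = -S`, the
adjacency matrix `A` is unchanged when rows and columns are relabelled by `(α, β)` or by `(β, α)`;
so odd powers of `A` are invariant under `(α, β)` and even powers under `(α, α)`. Modulo a prime
`q`, Frobenius turns `A ^ q ^ k` into the matrix counting representations by `q ^ k • s`, `s ∈ S`.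

For odd `p`, work in `ZMod p × ZMod 2`, where multiplication by `p` is the projection to `ZMod 2`
and multiplication by `2 ^ (p - 1)` the projection to `ZMod p`. The first forces the layers `S₀`,
`S₁` of `S` to have equal size (`eq_of_card_ne`) and `α`, `β` to share a first coordinate depending
only on `u`. The second, with twin-freeness, makes the second coordinate depend only on `i`. So `α
(u, i) = (f u, i + c)` and `β (u, i) = (f u, i + c')` with `c ≠ c'`, and `f` swaps the Cayley graphs
of `S₀` and `S₁`. A Sylow argument (`exists_unit_smul_of_swap`) replaces `f` by multiplication by a
unit, which is (C.4). For `p = 2` the graph would be the complete graph, which is stable. -/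

theorem Matrix.circulant_single_mul_circulant_single [AddCommGroup G] [Fintype G] {K : Type*} [Semiring K] (s t : G) :
    circulant (Pi.single s (1 : K)) * circulant (Pi.single t (1 : K)) =
      circulant (Pi.single (s + t) (1 : K)) := by
  rw [circulant_mul, mulVec_single_one]
  congr 1
  ext x
  simp [circulant_apply, Pi.single_apply, sub_eq_iff_eq_add]

theorem Matrix.circulant_single_pow [AddCommGroup G] [Fintype G] {K : Type*} [Semiring K] (s : G) (n : ℕ) :
    circulant (Pi.single s (1 : K)) ^ n = circulant (Pi.single (n • s) (1 : K)) := by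
  induction n with
  | zero => simp
  | succ n ih => rw [pow_succ, ih, circulant_single_mul_circulant_single, succ_nsmul]

/-- Circulant matrices over an abelian group commute, so Frobenius is additive on their sums. -/
theorem Matrix.sum_circulant_single_pow [AddCommGroup G] [Fintype G] {q : ℕ} [Fact q.Prime] (T : Finset G) (k : ℕ) :
    (∑ s ∈ T, circulant (Pi.single s (1 : ZMod q))) ^ q ^ k =
      ∑ s ∈ T, circulant (Pi.single (q ^ k • s) (1 : ZMod q)) := by
  have : CharP (Matrix G G (ZMod q)) q := inferInstance
  induction T using Finset.induction_on with
  | empty => simp [(Fact.out : q.Prime).ne_zero]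
  | insert a T ha ih =>
    rw [Finset.sum_insert ha, Finset.sum_insert ha, add_pow_char_pow_of_commute, ih,
      circulant_single_pow]
    exact Commute.sum_right _ _ _ fun s _ => circulant_mul_comm _ _

theorem Matrix.sum_circulant_single_apply [AddCommGroup G] {K : Type*} [Semiring K] (T : Finset G) (n : ℕ)
    (x y : G) : (∑ s ∈ T, circulant (Pi.single (n • s) (1 : K))) x y =
      ((T.filter fun s => n • s = x - y).card : K) := by
  rw [Matrix.sum_apply]
  simp [circulant_apply, Pi.single_apply, eq_comm]

/-- In `M * M` the inner index is relabelled by `β` in both factors, which only permutes the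
summands. -/
theorem Matrix.submatrix_pow_even [Fintype G] {K : Type*} [Semiring K] {M : Matrix G G K}
    {α β : Equiv.Perm G} (h : M.submatrix α β = M) (h' : M.submatrix β α = M) (j : ℕ) :
    (M ^ (2 * j)).submatrix α α = M ^ (2 * j) := by
  have h2 : (M * M).submatrix α α = M * M := by
    rw [← submatrix_mul_equiv M M α β α, h, h']
  induction j with
  | zero => simp
  | succ j ih =>
    rw [mul_add, pow_add, mul_one, pow_two M, ← submatrix_mul_equiv _ _ α α α, ih, h2]

theorem Matrix.submatrix_pow_odd [Fintype G] {K : Type*} [Semiring K] {M : Matrix G G K}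
    {α β : Equiv.Perm G} (h : M.submatrix α β = M) (h' : M.submatrix β α = M) (j : ℕ) :
    (M ^ (2 * j + 1)).submatrix α β = M ^ (2 * j + 1) := by
  rw [pow_succ, ← submatrix_mul_equiv _ _ α α β, submatrix_pow_even h h', h]

theorem submatrix_sum_circulant_single [AddCommGroup G] {K : Type*} [Semiring K] {T : Finset G}
    {α β : Equiv.Perm G} (h : ∀ x y, x - y ∈ T ↔ α x - β y ∈ T) :
    (∑ s ∈ T, circulant (Pi.single s (1 : K))).submatrix α β =
      ∑ s ∈ T, circulant (Pi.single s (1 : K)) := by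
  have aux : ∀ x y, (∑ s ∈ T, circulant (Pi.single s (1 : K))) x y =
      if x - y ∈ T then 1 else 0 := fun x y => by
    rw [Matrix.sum_apply]
    simp [circulant_apply, Pi.single_apply]
  ext x y
  simp only [submatrix_apply, aux, ← h]

/-- Multiplying the connection set by an odd prime power `q ^ k` gives a Cayley multigraph that is
preserved modulo `q`. -/
theorem card_filter_smul_odd [AddCommGroup G] [Fintype G] {q k : ℕ} [Fact q.Prime] (hq : Odd (q ^ k)) {T : Finset G}
    {α β : Equiv.Perm G} (h : ∀ x y, x - y ∈ T ↔ α x - β y ∈ T)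
    (h' : ∀ x y, x - y ∈ T ↔ β x - α y ∈ T) (x y : G) :
    ((T.filter fun s => q ^ k • s = α x - β y).card : ZMod q) =
      (T.filter fun s => q ^ k • s = x - y).card := by
  obtain ⟨j, hj⟩ := hq
  rw [← sum_circulant_single_apply, ← sum_circulant_single_apply, ← sum_circulant_single_pow, hj]
  exact congrFun (congrFun (submatrix_pow_odd (submatrix_sum_circulant_single h)
    (submatrix_sum_circulant_single h') j) x) y

theorem card_filter_smul_even [AddCommGroup G] [Fintype G] {q k : ℕ} [Fact q.Prime] (hq : Even (q ^ k)) {T : Finset G}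
    {α β : Equiv.Perm G} (h : ∀ x y, x - y ∈ T ↔ α x - β y ∈ T)
    (h' : ∀ x y, x - y ∈ T ↔ β x - α y ∈ T) (x y : G) :
    ((T.filter fun s => q ^ k • s = α x - α y).card : ZMod q) =
      (T.filter fun s => q ^ k • s = x - y).card := by
  obtain ⟨j, hj⟩ := even_iff_exists_two_mul.1 hq
  rw [← sum_circulant_single_apply, ← sum_circulant_single_apply, ← sum_circulant_single_pow, hj]
  exact congrFun (congrFun (submatrix_pow_even (submatrix_sum_circulant_single h)
    (submatrix_sum_circulant_single h') j) x) y

end Circulant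

/-! ### Replacing a swap of two Cayley graphs of prime order by a multiplication -/

/-- If `p` divides the order of a finite group only once, then its subgroups of order `p` are
conjugate. -/
theorem exists_conj_mem_zpowers {G : Type*} [Group G] [Finite G] {p : ℕ} [Fact p.Prime]
    (hG : ¬ p ^ 2 ∣ Nat.card G) {x y : G} (hx : orderOf x = p) (hy : orderOf y = p) :
    ∃ g : G, g * x * g⁻¹ ∈ Subgroup.zpowers y := by
  have hp : p.Prime := Fact.out
  have hfac : (Nat.card G).factorization p = 1 := by
    have h1 : (Nat.card G).factorization p < 2 := by
      by_contra! h
      exact hG ((hp.pow_dvd_iff_le_factorization Nat.card_pos.ne').2 h)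
    have h2 : 1 ≤ (Nat.card G).factorization p :=
      (hp.dvd_iff_one_le_factorization Nat.card_pos.ne').1 (hx ▸ orderOf_dvd_natCard x)
    omega
  have hc : ∀ z : G, orderOf z = p →
      Nat.card (Subgroup.zpowers z) = p ^ (Nat.card G).factorization p := fun z hz => by
    rw [hfac, pow_one, Nat.card_zpowers, hz]
  obtain ⟨g, hg⟩ := MulAction.exists_smul_eq G (Sylow.ofCard _ (hc x hx)) (Sylow.ofCard _ (hc y hy))
  refine ⟨g, ?_⟩
  have h1 : g * x * g⁻¹ ∈ g • Sylow.ofCard _ (hc x hx) :=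
    Subgroup.mem_map.2 ⟨x, Subgroup.mem_zpowers x, rfl⟩
  rw [hg] at h1
  exact h1

/-- A permutation of `ℤ/pℤ` that swaps two Cayley graphs can be replaced by a multiplication. -/
theorem exists_unit_smul_of_swap {p : ℕ} [Fact p.Prime] (f : Equiv.Perm (ZMod p))
    (S : ZMod 2 → Set (ZMod p)) (hf : ∀ i u v, u - v ∈ S i ↔ f u - f v ∈ S (i + 1)) :
    ∃ m : (ZMod p)ˣ, ∀ i u, u ∈ S i ↔ (m : ZMod p) * u ∈ S (i + 1) := by
  have hp : p.Prime := Fact.out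
  -- The common automorphisms of both Cayley graphs. Besides the translation `ρ`, they contain its
  -- conjugate by `f`, as `f` only exchanges the two graphs.
  let H : Subgroup (Equiv.Perm (ZMod p)) :=
    { carrier := {h | ∀ i u v, h u - h v ∈ S i ↔ u - v ∈ S i}
      mul_mem' := fun {a b} ha hb i u v => (ha i _ _).trans (hb i u v)
      one_mem' := fun _ _ _ => Iff.rfl
      inv_mem' := fun {a} ha i u v => by
        have := ha i (a⁻¹ u) (a⁻¹ v)
        simpa using this.symm }
  have hmem : ∀ h : Equiv.Perm (ZMod p), h ∈ H ↔ ∀ i u v, h u - h v ∈ S i ↔ u - v ∈ S i :=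
    fun _ => Iff.rfl
  let ρ : Equiv.Perm (ZMod p) := Equiv.addLeft 1
  have hρz : ∀ n : ℤ, ρ ^ n = Equiv.addLeft (n : ZMod p) := fun n => by
    simp [ρ]
  have hρp : orderOf ρ = p := by
    refine orderOf_eq_prime ?_ ?_
    · have := hρz p
      simpa using this
    · intro h
      have := congrArg (fun e : Equiv.Perm (ZMod p) => e 0) h
      simp [ρ] at this
  have hρ : ρ ∈ H := (hmem _).2 fun i u v => by simp [ρ]
  have hρ' : f * ρ * f⁻¹ ∈ H := (hmem _).2 fun i u v => by
    obtain ⟨j, rfl⟩ : ∃ j, i = j + 1 := ⟨i - 1, by ring⟩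
    have h1 := hf j (ρ (f⁻¹ u)) (ρ (f⁻¹ v))
    have h2 := hf j (f⁻¹ u) (f⁻¹ v)
    rw [(hmem _).1 hρ] at h1
    simp only [Equiv.Perm.mul_apply, ← h1, h2]
    simp
  -- The order of `H` divides `p!`, in which `p` occurs only once.
  have hH : ¬ p ^ 2 ∣ Nat.card H := fun h => by
    have h1 : p ^ 2 ∣ p.factorial := by
      have := h.trans H.card_subgroup_dvd_card
      rwa [Nat.card_perm, Nat.card_zmod] at this
    rw [← Nat.mul_factorial_pred hp.ne_zero, pow_two] at h1
    have h2 := (hp.dvd_factorial).1 (Nat.dvd_of_mul_dvd_mul_left hp.pos h1)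
    have := hp.pos
    omega
  obtain ⟨⟨h, hh⟩, hconj⟩ := exists_conj_mem_zpowers (p := p) hH (x := (⟨_, hρ'⟩ : H))
    (y := (⟨ρ, hρ⟩ : H))
    (((Subgroup.orderOf_coe _).symm.trans
      (orderOf_injective (MulAut.conj f).toMonoidHom (MulAut.conj f).injective ρ)).trans hρp)
    ((Subgroup.orderOf_coe _).symm.trans hρp)
  obtain ⟨k, hk⟩ := Subgroup.mem_zpowers_iff.1 hconj
  have hk' : ρ ^ k = h * (f * ρ * f⁻¹) * h⁻¹ := congrArg Subtype.val hk
  -- Since `h ∈ H`, this map swaps the two graphs just as `f` does; it also turns translation by `1`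
  -- into translation by `k`, hence is affine with slope `k`.
  let g := h * f
  have hg : ∀ u, g (1 + u) = k + g u := fun u => by
    have h1 : ρ ^ k * g = g * ρ := by rw [hk']; simp only [g]; group
    have h2 := congrArg (fun e : Equiv.Perm (ZMod p) => e u) h1
    rw [hρz] at h2
    exact h2.symm
  have hgn : ∀ n : ℕ, g n = k * n + g 0 := fun n => by
    induction n with
    | zero => simp
    | succ n ih => rw [Nat.cast_succ, add_comm, hg, ih]; ring
  have hgu : ∀ u, g u = k * u + g 0 := fun u => by
    have := hgn u.val
    rwa [ZMod.natCast_zmod_val] at this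
  have hk0 : (k : ZMod p) ≠ 0 := fun h0 => by
    have := g.injective ((hgu 1).trans (by rw [h0]; simp) : g 1 = g 0)
    exact one_ne_zero this
  refine ⟨Units.mk0 _ hk0, fun i u => ?_⟩
  have h1 := hf i u 0
  rw [sub_zero, ← (hmem h).1 hh] at h1
  rw [h1]
  change g u - g 0 ∈ _ ↔ _
  rw [hgu u]
  simp

theorem injOn_fst_filter_snd {p : ℕ} (T : Finset (ZMod p × ZMod 2)) (i : ZMod 2) :
    Set.InjOn Prod.fst (T.filter fun s => s.2 = i : Set (ZMod p × ZMod 2)) := by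
  intro a ha b hb h
  simp only [Finset.coe_filter, Set.mem_ofPred_eq] at ha hb
  exact Prod.ext h (ha.2.trans hb.2.symm)

/-! ### Pairs of permutations preserving a Cayley graph of `ZMod p × ZMod 2` -/

section TwoP

variable {p : ℕ} [Fact p.Prime]

theorem nsmul_prime_prod_two (hp2 : p ≠ 2) (s : ZMod p × ZMod 2) : p ^ 1 • s = (0, s.2) := by
  have hodd : (p : ZMod 2) = 1 := (ZMod.natCast_eq_one_iff_odd).2
    ((Fact.out : p.Prime).odd_of_ne_two hp2)
  ext <;> simp [hodd]

/-- Fermat's little theorem dictates the exponent `p - 1`. -/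
theorem nsmul_two_pow_prod_two (hp2 : p ≠ 2) (s : ZMod p × ZMod 2) :
    2 ^ (p - 1) • s = (s.1, 0) := by
  have hp : p.Prime := Fact.out
  have h2 : (2 : ZMod p) ≠ 0 := by
    intro h
    have : (p : ℕ) ∣ 2 := (ZMod.natCast_eq_zero_iff 2 p).1 (by exact_mod_cast h)
    exact hp2 ((Nat.prime_dvd_prime_iff_eq hp Nat.prime_two).1 this)
  have h0 : (2 : ZMod 2) = 0 := rfl
  have hp1 : p - 1 ≠ 0 := by have := hp.two_le; omega
  ext
  · simp [ZMod.pow_card_sub_one_eq_one h2]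
  · simp [h0, hp1]

theorem card_filter_nsmul_prime (hp2 : p ≠ 2) (T : Finset (ZMod p × ZMod 2)) (i : ZMod 2) :
    (T.filter fun s => p ^ 1 • s = (0, i)).card = (T.filter fun s => s.2 = i).card := by
  simp_rw [nsmul_prime_prod_two hp2, Prod.mk.injEq, true_and]

theorem fst_eq_zero_of_card_filter_ne_zero (hp2 : p ≠ 2) {T : Finset (ZMod p × ZMod 2)}
    {z : ZMod p × ZMod 2} (h : ((T.filter fun s => p ^ 1 • s = z).card : ZMod p) ≠ 0) :
    z.1 = 0 := by
  obtain ⟨s, hs⟩ : (T.filter fun s => p ^ 1 • s = z).Nonempty := by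
    rw [Finset.nonempty_iff_ne_empty]
    intro h0
    rw [h0, Finset.card_empty, Nat.cast_zero] at h
    exact h rfl
  rw [← (Finset.mem_filter.1 hs).2, nsmul_prime_prod_two hp2]

theorem card_filter_snd_le (T : Finset (ZMod p × ZMod 2)) (i : ZMod 2) :
    (T.filter fun s => s.2 = i).card ≤ p := by
  rw [← Finset.card_image_of_injOn (injOn_fst_filter_snd T i)]
  exact (Finset.card_le_univ _).trans (ZMod.card p).le

theorem card_filter_snd_lt {T : Finset (ZMod p × ZMod 2)} {i : ZMod 2} (h : (0, i) ∉ T) :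
    (T.filter fun s => s.2 = i).card < p := by
  rw [← Finset.card_image_of_injOn (injOn_fst_filter_snd T i)]
  refine (Finset.card_lt_univ_of_notMem (x := 0) ?_).trans_le (ZMod.card p).le
  simp only [Finset.mem_image, Finset.mem_filter, not_exists, not_and]
  rintro ⟨u, j⟩ ⟨h1, rfl⟩ rfl
  exact h h1

theorem exists_mem_layer_zero_not_mem_layer_one {T : Finset (ZMod p × ZMod 2)}
    (hT : ¬ ∀ u, (u, (0 : ZMod 2)) ∈ T ↔ (u, (1 : ZMod 2)) ∈ T)
    (hcard : (T.filter fun s => s.2 = 0).card = (T.filter fun s => s.2 = 1).card) :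
    ∃ u, (u, (0 : ZMod 2)) ∈ T ∧ (u, (1 : ZMod 2)) ∉ T := by
  by_contra! H
  have hm : ∀ (i : ZMod 2) u, u ∈ (T.filter fun s => s.2 = i).image Prod.fst ↔ (u, i) ∈ T := by
    intro i u
    simp
  have hsub : (T.filter fun s => s.2 = 0).image Prod.fst ⊆
      (T.filter fun s => s.2 = 1).image Prod.fst := fun u hu =>
    (hm 1 u).2 (H u ((hm 0 u).1 hu))
  have heq := Finset.eq_of_subset_of_card_le hsub (by
    rw [Finset.card_image_of_injOn (injOn_fst_filter_snd T _),
      Finset.card_image_of_injOn (injOn_fst_filter_snd T _), hcard])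
  exact hT fun u => by rw [← hm, ← hm, heq]

theorem zmod_two_eq_zero_or_one : ∀ i : ZMod 2, i = 0 ∨ i = 1 := by decide

theorem zmod_two_eq_one_add_of_ne : ∀ a b : ZMod 2, a ≠ b → a = 1 + b := by decide

theorem zmod_two_add_sub_of_ne : ∀ i a b : ZMod 2, a ≠ b → i + a - (0 + b) = i + 1 := by decide

variable {T : Finset (ZMod p × ZMod 2)} {α β : Equiv.Perm (ZMod p × ZMod 2)}

/-- If the two layers of the connection set have sizes that differ modulo `p`, then it is stable. -/
theorem eq_of_card_ne (hp2 : p ≠ 2) (h : ∀ x y, x - y ∈ T ↔ α x - β y ∈ T)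
    (h' : ∀ x y, x - y ∈ T ↔ β x - α y ∈ T)
    (h0 : ((T.filter fun s => s.2 = 0).card : ZMod p) ≠ 0)
    (hne : ((T.filter fun s => s.2 = 0).card : ZMod p) ≠ (T.filter fun s => s.2 = 1).card) :
    α = β := by
  have hp : p.Prime := Fact.out
  ext1 x
  -- Diagonal entries of `A ^ p` count the layer over `0`, which is nonzero modulo `p`; the entry at
  -- `(α x, β x)` must agree.
  have key := card_filter_smul_odd (q := p) (k := 1) (by simpa using hp.odd_of_ne_two hp2) h h' x x
  rw [sub_self, Prod.zero_eq_mk, card_filter_nsmul_prime hp2] at key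
  have h1 := fst_eq_zero_of_card_filter_ne_zero hp2 (key.trans_ne h0)
  have h2 : α x - β x = (0, (α x - β x).2) := Prod.ext h1 rfl
  rw [h2, card_filter_nsmul_prime hp2] at key
  rcases zmod_two_eq_zero_or_one (α x - β x).2 with h3 | h3
  · rw [h3] at h2
    exact sub_eq_zero.1 h2
  · rw [h3] at key
    exact absurd key.symm hne

theorem fst_sub_eq_zero_of_card_eq (hp2 : p ≠ 2) (h : ∀ x y, x - y ∈ T ↔ α x - β y ∈ T)
    (h' : ∀ x y, x - y ∈ T ↔ β x - α y ∈ T)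
    (h0 : ((T.filter fun s => s.2 = 0).card : ZMod p) ≠ 0)
    (heq : (T.filter fun s => s.2 = 0).card = (T.filter fun s => s.2 = 1).card)
    (x : ZMod p × ZMod 2) (i : ZMod 2) : (α (x + (0, i)) - β x).1 = 0 := by
  have hp : p.Prime := Fact.out
  have key := card_filter_smul_odd (q := p) (k := 1) (by simpa using hp.odd_of_ne_two hp2) h h'
    (x + (0, i)) x
  rw [add_sub_cancel_left, card_filter_nsmul_prime hp2] at key
  refine fst_eq_zero_of_card_filter_ne_zero hp2 (key.trans_ne ?_)
  rcases zmod_two_eq_zero_or_one i with rfl | rfl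
  · exact h0
  · rwa [← heq]

/-- Exactly one element of `T` lies over `u`, so the entry of `A ^ 2 ^ (p - 1)` at difference `(u,
0)` is odd. Its image under `(α, α)` is then nonzero, which only happens at differences with second
coordinate `0`. -/
theorem snd_apply_add_of_mem (hp2 : p ≠ 2) (h : ∀ x y, x - y ∈ T ↔ α x - β y ∈ T)
    (h' : ∀ x y, x - y ∈ T ↔ β x - α y ∈ T) {u : ZMod p} (hu0 : (u, (0 : ZMod 2)) ∈ T)
    (hu1 : (u, (1 : ZMod 2)) ∉ T) (x : ZMod p × ZMod 2) :
    (α (x + (u, 0))).2 = (α x).2 := by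
  have hp1 : p - 1 ≠ 0 := by have := (Fact.out : p.Prime).two_le; omega
  have key := card_filter_smul_even (q := 2) (k := p - 1) (by simp [Nat.even_pow, hp1]) h h'
    (x + (u, 0)) x
  have h1 : (T.filter fun s => 2 ^ (p - 1) • s = x + (u, 0) - x) = {(u, 0)} := by
    ext ⟨v, j⟩
    simp only [nsmul_two_pow_prod_two hp2, add_sub_cancel_left, Finset.mem_filter, Prod.mk.injEq,
      and_true, Finset.mem_singleton]
    rcases zmod_two_eq_zero_or_one j with rfl | rfl
    · simp only [and_true]
      exact ⟨fun h => h.2, fun h => ⟨h ▸ hu0, h⟩⟩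
    · simp only [one_ne_zero, and_false, iff_false]
      rintro ⟨h1, rfl⟩
      exact hu1 h1
  rw [h1, Finset.card_singleton] at key
  obtain ⟨s, hs⟩ : (T.filter fun s => 2 ^ (p - 1) • s = α (x + (u, 0)) - α x).Nonempty := by
    rw [Finset.nonempty_iff_ne_empty]
    intro h0
    rw [h0, Finset.card_empty, Nat.cast_zero, Nat.cast_one] at key
    exact zero_ne_one key
  have h2 := (Finset.mem_filter.1 hs).2
  rw [nsmul_two_pow_prod_two hp2] at h2
  exact sub_eq_zero.1 (congrArg Prod.snd h2).symm

theorem exists_eq_prod (hp2 : p ≠ 2) (h : ∀ x y, x - y ∈ T ↔ α x - β y ∈ T)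
    (h' : ∀ x y, x - y ∈ T ↔ β x - α y ∈ T)
    (h0 : ((T.filter fun s => s.2 = 0).card : ZMod p) ≠ 0)
    (heq : (T.filter fun s => s.2 = 0).card = (T.filter fun s => s.2 = 1).card)
    {d : ZMod p} (hd : d ≠ 0) (hd0 : (d, (0 : ZMod 2)) ∈ T) (hd1 : (d, (1 : ZMod 2)) ∉ T) :
    ∃ c : ZMod 2, ∀ u i, α (u, i) = ((β (u, 0)).1, i + c) := by
  have hsnd : ∀ u i, (α (u, i)).2 = (α (0, i)).2 := fun u i => by
    -- As `d` generates `ZMod p`, steps by `(d, 0)` reach every point with the same second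
    -- coordinate.
    have hn : ∀ n : ℕ, (α ((n : ZMod p) * d, i)).2 = (α (0, i)).2 := fun n => by
      induction n with
      | zero => simp
      | succ n ih =>
        rw [← ih, ← snd_apply_add_of_mem hp2 h h' hd0 hd1 ((n : ZMod p) * d, i)]
        congr 2
        ext <;> simp [add_mul]
    have := hn (u * d⁻¹).val
    rwa [ZMod.natCast_zmod_val, inv_mul_cancel_right₀ hd] at this
  have hfst : ∀ u i, (α (u, i)).1 = (β (u, 0)).1 := fun u i => by
    have := fst_sub_eq_zero_of_card_eq hp2 h h' h0 heq (u, 0) i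
    simpa [sub_eq_zero] using this
  refine ⟨(α (0, 0)).2, fun u i => Prod.ext (hfst u i) ?_⟩
  rw [hsnd]
  rcases zmod_two_eq_zero_or_one i with rfl | rfl
  · simp
  · have hne : (α (0, 1)).2 ≠ (α (0, 0)).2 := fun he => by
      have := α.injective (Prod.ext ((hfst 0 1).trans (hfst 0 0).symm) he)
      simp at this
    exact zmod_two_eq_one_add_of_ne _ _ hne

/-- The stability theorem for Cayley graphs of `ℤ/pℤ × ℤ/2ℤ`. -/
theorem eq_or_exists_unit (hp2 : p ≠ 2) (h : ∀ x y, x - y ∈ T ↔ α x - β y ∈ T)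
    (hneg : ∀ s ∈ T, -s ∈ T) (hT0 : (0, 0) ∉ T) (hne0 : ∃ s ∈ T, s.2 = 0)
    (hne1 : ∃ s ∈ T, s.2 = 1)
    (hT : ¬ ∀ u, (u, (0 : ZMod 2)) ∈ T ↔ (u, (1 : ZMod 2)) ∈ T) :
    α = β ∨ ∃ m : (ZMod p)ˣ, ∀ u i, (u, i) ∈ T ↔ ((m : ZMod p) * u, i + 1) ∈ T := by
  have hsymm : ∀ x y, x - y ∈ T ↔ y - x ∈ T := fun x y =>
    ⟨fun h => neg_sub x y ▸ hneg _ h, fun h => neg_sub y x ▸ hneg _ h⟩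
  have h' : ∀ x y, x - y ∈ T ↔ β x - α y ∈ T := fun x y => by
    rw [hsymm, h, hsymm]
  have hlt0 := card_filter_snd_lt hT0
  have hle1 := card_filter_snd_le T 1
  have hpos : ∀ i : ZMod 2, (∃ s ∈ T, s.2 = i) → 0 < (T.filter fun s => s.2 = i).card :=
    fun i ⟨s, hs, hi⟩ => Finset.card_pos.2 ⟨s, Finset.mem_filter.2 ⟨hs, hi⟩⟩
  have hpos0 := hpos 0 hne0
  have hpos1 := hpos 1 hne1
  have h0 : ((T.filter fun s => s.2 = 0).card : ZMod p) ≠ 0 := fun h0 =>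
    absurd (Nat.le_of_dvd hpos0 ((ZMod.natCast_eq_zero_iff _ _).1 h0)) hlt0.not_ge
  by_cases hmod : ((T.filter fun s => s.2 = 0).card : ZMod p) = (T.filter fun s => s.2 = 1).card
  swap
  · exact Or.inl (eq_of_card_ne hp2 h h' h0 hmod)
  have heq : (T.filter fun s => s.2 = 0).card = (T.filter fun s => s.2 = 1).card := by
    -- Layer `1` may contain `(0, 1)`, so only `≤ p` is immediate; size `p` would make layer `0`
    -- vanish modulo `p`.
    have hlt1 : (T.filter fun s => s.2 = 1).card < p := by
      refine lt_of_le_of_ne hle1 fun h1 => h0 ?_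
      rw [hmod, h1, ZMod.natCast_self]
    rw [ZMod.natCast_eq_natCast_iff'] at hmod
    rwa [Nat.mod_eq_of_lt hlt0, Nat.mod_eq_of_lt hlt1] at hmod
  obtain ⟨d, hd0, hd1⟩ := exists_mem_layer_zero_not_mem_layer_one hT heq
  have hd : d ≠ 0 := by rintro rfl; exact hT0 hd0
  obtain ⟨c, hc⟩ := exists_eq_prod hp2 h h' h0 heq hd hd0 hd1
  obtain ⟨c', hc'⟩ := exists_eq_prod hp2 h' h h0 heq hd hd0 hd1
  have hfst : ∀ u, (β (u, 0)).1 = (α (u, 0)).1 := fun u => by rw [hc' u 0]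
  by_cases hcc : c = c'
  · left
    ext1 ⟨u, i⟩
    rw [hc, hfst, hcc, ← hc']
  right
  have hinj : Function.Injective fun u => (α (u, 0)).1 := fun u v huv => by
    have : α (u, 0) = α (v, 0) := Prod.ext huv (by rw [hc u, hc v])
    simpa using α.injective this
  obtain ⟨m, hm⟩ := exists_unit_smul_of_swap
    (Equiv.ofBijective _ (Finite.injective_iff_bijective.1 hinj)) (fun i => {u | (u, i) ∈ T})
    (fun i u v => by
      have h1 := h (u, i) (v, 0)
      have h2 : i + c - (0 + c') = i + 1 := zmod_two_add_sub_of_ne i c c' hcc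
      rw [hc u i, hc' v 0, hfst u, Prod.mk_sub_mk, Prod.mk_sub_mk, h2, sub_zero] at h1
      exact h1)
  exact ⟨m, fun u i => hm i u⟩

end TwoP

/-! ### Automorphisms of the double cover -/

theorem SimpleGraph.Connected.eq_of_adj_eq {V C : Type*} {X : SimpleGraph V} (hX : X.Connected)
    {f : V → C} (hf : ∀ v w, X.Adj v w → f v = f w) (v w : V) : f v = f w := by
  obtain ⟨q⟩ := hX.preconnected v w
  induction q with
  | nil => rfl
  | cons h _ ih => exact (hf _ _ h).trans ih

theorem SimpleGraph.isBipartite_of_bool {V : Type*} {X : SimpleGraph V} (f : V → Bool)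
    (hf : ∀ v w, X.Adj v w → f v ≠ f w) : X.IsBipartite := by
  have h : X.Coloring Bool := SimpleGraph.Coloring.mk f (fun {v w} h => hf v w h)
  simpa using h.colorable

theorem isRight_ne_of_bipartiteDoubleCover_adj {V : Type*} {X : SimpleGraph V} {a b : V ⊕ V}
    (h : X.bipartiteDoubleCover.Adj a b) : a.isRight ≠ b.isRight := by
  rcases a with a | a <;> rcases b with b | b <;> simp_all

/-- An automorphism of the double cover of a connected nonbipartite graph preserves the two layers
or swaps them. -/
theorem exists_layer {V : Type*} {X : SimpleGraph V} (hc : X.Connected) (hb : ¬ X.IsBipartite)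
    (g : X.bipartiteDoubleCover ≃g X.bipartiteDoubleCover) :
    ∃ c : Bool, ∀ v, (g (Sum.inl v)).isRight = c ∧ (g (Sum.inr v)).isRight = !c := by
  have key : ∀ v w, X.Adj v w → (g (Sum.inl v)).isRight ≠ (g (Sum.inr w)).isRight := fun v w h =>
    isRight_ne_of_bipartiteDoubleCover_adj
      (g.map_rel_iff.2 (show X.bipartiteDoubleCover.Adj (Sum.inl v) (Sum.inr w) from h))
  -- Whether the two copies of a vertex land in different layers is constant along edges. If they
  -- landed in the same layer, that layer would be a proper 2-colouring of `X`.
  have hconst : ∀ v w, ((g (Sum.inl v)).isRight ^^ (g (Sum.inr v)).isRight) =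
      ((g (Sum.inl w)).isRight ^^ (g (Sum.inr w)).isRight) := by
    refine hc.eq_of_adj_eq fun v w h => ?_
    have h1 := key v w h
    have h2 := key w v h.symm
    revert h1 h2
    cases (g (Sum.inl v)).isRight <;> cases (g (Sum.inr v)).isRight <;>
      cases (g (Sum.inl w)).isRight <;> cases (g (Sum.inr w)).isRight <;> simp
  obtain ⟨v₀⟩ := hc.nonempty
  cases he : ((g (Sum.inl v₀)).isRight ^^ (g (Sum.inr v₀)).isRight) with
  | false =>
    refine absurd (SimpleGraph.isBipartite_of_bool (fun v => (g (Sum.inl v)).isRight) ?_) hb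
    intro v w h
    have h1 := key v w h
    have h2 := (hconst w v₀).trans he
    revert h1 h2
    cases (g (Sum.inl v)).isRight <;> cases (g (Sum.inl w)).isRight <;>
      cases (g (Sum.inr w)).isRight <;> simp
  | true =>
    refine ⟨(g (Sum.inl v₀)).isRight, fun v => ?_⟩
    have h1 : (g (Sum.inl v)).isRight = (g (Sum.inl v₀)).isRight := by
      refine hc.eq_of_adj_eq (f := fun v => (g (Sum.inl v)).isRight) (fun v w h => ?_) v v₀
      have h1 := key v w h
      have h2 := (hconst w v₀).trans he
      revert h1 h2
      cases (g (Sum.inl v)).isRight <;> cases (g (Sum.inl w)).isRight <;>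
        cases (g (Sum.inr w)).isRight <;> simp
    have h2 := (hconst v v₀).trans he
    rw [h1] at h2
    refine ⟨h1, ?_⟩
    revert h2
    cases (g (Sum.inl v₀)).isRight <;> cases (g (Sum.inr v)).isRight <;> simp

/-- If `X` is connected, nonbipartite and unstable, then its adjacency relation is preserved by a
pair of different permutations. -/
theorem exists_perm_ne_of_isUnstable {V : Type*} {X : SimpleGraph V} (hc : X.Connected)
    (hb : ¬ X.IsBipartite) (hu : IsUnstable X) :
    ∃ α β : Equiv.Perm V, (∀ v w, X.Adj v w ↔ X.Adj (α v) (β w)) ∧ α ≠ β := by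
  by_contra! H
  have hleft : ∀ g : X.bipartiteDoubleCover ≃g X.bipartiteDoubleCover,
      (∀ v, (g (Sum.inl v)).isRight = false ∧ (g (Sum.inr v)).isRight = true) →
      g ∈ (doubleCoverAutHom X).range := by
    intro g hg
    have hl : ∀ v, ∃ w, g (Sum.inl v) = Sum.inl w := fun v => by
      have := (hg v).1
      rcases h : g (Sum.inl v) with w | w
      · exact ⟨w, rfl⟩
      · rw [h] at this; cases this
    have hr : ∀ v, ∃ w, g (Sum.inr v) = Sum.inr w := fun v => by
      have := (hg v).2
      rcases h : g (Sum.inr v) with w | w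
      · rw [h] at this; cases this
      · exact ⟨w, rfl⟩
    choose a ha using hl
    choose b hb using hr
    have hab : Function.Bijective a := by
      constructor
      · intro v w h
        exact Sum.inl_injective (g.injective (by rw [ha, ha, h]))
      · intro w
        obtain ⟨v | v, hv⟩ := g.surjective (Sum.inl w)
        · exact ⟨v, Sum.inl_injective ((ha v).symm.trans hv)⟩
        · rw [hb] at hv; cases hv
    have hbb : Function.Bijective b := by
      constructor
      · intro v w h
        exact Sum.inr_injective (g.injective (by rw [hb, hb, h]))
      · intro w
        obtain ⟨v | v, hv⟩ := g.surjective (Sum.inr w)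
        · rw [ha] at hv; cases hv
        · exact ⟨v, Sum.inr_injective ((hb v).symm.trans hv)⟩
    have hadj : ∀ v w, X.Adj v w ↔ X.Adj (a v) (b w) := by
      intro v w
      have := g.map_rel_iff (a := Sum.inl v) (b := Sum.inr w)
      rw [ha, hb] at this
      exact this.symm
    have hEq := H (Equiv.ofBijective a hab) (Equiv.ofBijective b hbb) hadj
    have hab' : ∀ v, b v = a v := fun v => (congrArg (fun e : Equiv.Perm V => e v) hEq).symm
    refine ⟨(⟨Equiv.ofBijective a hab, fun {v w} => ?_⟩, 1), ?_⟩
    · simpa [hab'] using (hadj v w).symm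
    · apply RelIso.ext
      rintro (v | v)
      · exact (ha v).symm
      · exact ((hb v).trans (congrArg _ (hab' v))).symm
  apply hu
  rw [eq_top_iff]
  intro g _
  obtain ⟨c, hg⟩ := exists_layer hc hb g
  cases c with
  | false => exact hleft g hg
  | true =>
    -- Composing with the layer swap, itself in the subgroup, reduces to the layer-preserving case.
    set s := doubleCoverAutHom X (1, Equiv.swap false true)
    have hs : s ∈ (doubleCoverAutHom X).range := ⟨_, rfl⟩
    refine (Subgroup.mul_mem_cancel_left _ hs).1 (hleft (s * g) fun v => ?_)
    have hsr : ∀ x, (s x).isRight = !x.isRight := by rintro (x | x) <;> rfl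
    change (s (g _)).isRight = _ ∧ (s (g _)).isRight = _
    rw [hsr, hsr, (hg v).1, (hg v).2]
    simp

/-! ### Application to circulant graphs -/

theorem addCayley_adj_iff {G : Type*} [AddCommGroup G] {S : Set G} (hneg : ∀ s ∈ S, -s ∈ S)
    (h0 : (0 : G) ∉ S) (v w : G) : (SimpleGraph.addCayley S).Adj v w ↔ v - w ∈ S := by
  rw [SimpleGraph.addCayley_adj]
  constructor
  · rintro ⟨-, h | h⟩
    · simpa [sub_eq_add_neg, add_comm] using hneg _ h
    · simpa [sub_eq_add_neg, add_comm] using h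
  · intro h
    refine ⟨?_, Or.inr (by simpa [sub_eq_add_neg, add_comm] using h)⟩
    rintro rfl
    exact h0 (by simpa using h)

section Parity

variable {G : Type*} [AddCommGroup G] {S : Set G}

/-- Otherwise `π` would be constant on the connected graph. -/
theorem exists_mem_apply_eq_one (hneg : ∀ s ∈ S, -s ∈ S) (h0 : (0 : G) ∉ S)
    (hc : (SimpleGraph.addCayley S).Connected) (π : G →+ ZMod 2) (hπ : Function.Surjective π) :
    ∃ s ∈ S, π s = 1 := by
  by_contra! H
  obtain ⟨x, hx⟩ := hπ 1
  have := hc.eq_of_adj_eq (f := π) (fun v w h => by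
    have h1 := (zmod_two_eq_zero_or_one _).resolve_right
      (H _ ((addCayley_adj_iff hneg h0 v w).1 h))
    rwa [map_sub, sub_eq_zero] at h1) x 0
  rw [hx, map_zero] at this
  exact one_ne_zero this

/-- Otherwise `π` would be a proper 2-colouring. -/
theorem exists_mem_apply_eq_zero (hneg : ∀ s ∈ S, -s ∈ S) (h0 : (0 : G) ∉ S)
    (hb : ¬ (SimpleGraph.addCayley S).IsBipartite) (π : G →+ ZMod 2) : ∃ s ∈ S, π s = 0 := by
  by_contra! H
  refine hb (SimpleGraph.isBipartite_of_bool (fun v => decide (π v = 0)) fun v w h he => ?_)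
  have h1 := H _ ((addCayley_adj_iff hneg h0 v w).1 h)
  rw [map_sub] at h1
  rcases zmod_two_eq_zero_or_one (π v) with h2 | h2 <;>
    rcases zmod_two_eq_zero_or_one (π w) with h3 | h3 <;> simp [h2, h3] at h1 he

end Parity

theorem exists_perm_ne_of_isNontriviallyUnstable {G : Type*} [AddCommGroup G] {S : Set G}
    (hneg : ∀ s ∈ S, -s ∈ S) (h0 : (0 : G) ∉ S)
    (hX : IsNontriviallyUnstable (SimpleGraph.addCayley S)) :
    ∃ α β : Equiv.Perm G, (∀ v w, v - w ∈ S ↔ α v - β w ∈ S) ∧ α ≠ β := by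
  obtain ⟨α, β, h, hne⟩ := exists_perm_ne_of_isUnstable hX.1 hX.2.1 hX.2.2.2
  exact ⟨α, β, fun v w => by
    rw [← addCayley_adj_iff hneg h0, ← addCayley_adj_iff hneg h0, h], hne⟩

/-- There is no nontrivially unstable circulant graph of order four. -/
theorem not_isNontriviallyUnstable_of_zmod_four {S : Set (ZMod (2 * 2))}
    (hneg : ∀ s ∈ S, -s ∈ S) (h0 : (0 : ZMod (2 * 2)) ∉ S) :
    ¬ IsNontriviallyUnstable (SimpleGraph.addCayley S) := by
  intro hX
  have h2 : 2 ∣ 2 * 2 := ⟨2, rfl⟩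
  let π := (ZMod.castHom h2 (ZMod 2)).toAddMonoidHom
  obtain ⟨s, hs, hs1⟩ := exists_mem_apply_eq_one hneg h0 hX.1 π (ZMod.castHom_surjective h2)
  obtain ⟨r, hr, hr0⟩ := exists_mem_apply_eq_zero hneg h0 hX.2.1 π
  have hmem : ∀ x, x ∈ S ↔ x ≠ 0 := fun x => by
    refine ⟨fun h => ne_of_mem_of_not_mem h h0, fun hx => ?_⟩
    have hcases : ∀ s r x : ZMod (2 * 2), (s.cast : ZMod 2) = 1 → (r.cast : ZMod 2) = 0 →
        r ≠ 0 → x ≠ 0 → x = s ∨ x = -s ∨ x = r := by decide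
    rcases hcases s r x hs1 hr0 (ne_of_mem_of_not_mem hr h0) hx with rfl | rfl | rfl
    · exact hs
    · exact hneg _ hs
    · exact hr
  obtain ⟨α, β, h, hne⟩ := exists_perm_ne_of_isNontriviallyUnstable hneg h0 hX
  -- In a complete graph only equal vertices are non-adjacent, so `x - x ∉ S` gives `α x = β x`.
  refine hne (Equiv.ext fun x => ?_)
  have := h x x
  simp only [hmem, sub_self, ne_eq, not_true_eq_false, false_iff, not_not, sub_eq_zero] at this
  exact this

theorem hasWilsonTypeC4_of_forall {n : ℕ} {S : Set (ZMod n)} (m : (ZMod n)ˣ)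
    (hm : ∀ x, x ∈ S ↔ ((n / 2 : ℕ) : ZMod n) + m * x ∈ S) : HasWilsonTypeC4 n S := by
  refine ⟨m, Set.ext fun y => ?_⟩
  rw [Set.mem_vadd_set]
  constructor
  · rintro ⟨z, hz, rfl⟩
    obtain ⟨x, hx, rfl⟩ := Set.mem_smul_set.1 hz
    exact (hm x).1 hx
  · intro hy
    have h1 : ((n / 2 : ℕ) : ZMod n) +
        m * ((m⁻¹ : (ZMod n)ˣ) * (y - ((n / 2 : ℕ) : ZMod n))) = y := by
      rw [Units.mul_inv_cancel_left, add_sub_cancel]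
    exact ⟨_, Set.mem_smul_set.2 ⟨_, (hm _).2 (h1.symm ▸ hy), rfl⟩, h1⟩

theorem mainTheorem1 (p : ℕ) (hp : p.Prime) (S : Set (ZMod (2 * p)))
    (hSneg : ∀ s ∈ S, -s ∈ S) (hS0 : (0 : ZMod (2 * p)) ∉ S)
    (hX : IsNontriviallyUnstable (SimpleGraph.addCayley S)) :
    HasWilsonTypeC4 (2 * p) S := by
  rcases eq_or_ne p 2 with rfl | hp2
  · exact absurd hX (not_isNontriviallyUnstable_of_zmod_four hSneg hS0)
  have : Fact p.Prime := ⟨hp⟩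
  have hodd := hp.odd_of_ne_two hp2
  let e : ZMod (2 * p) ≃+* ZMod p × ZMod 2 :=
    (ZMod.chineseRemainder (Nat.coprime_two_left.2 hodd)).trans RingEquiv.prodComm
  have hep : e (p : ZMod (2 * p)) = (0, 1) := by
    rw [map_natCast]
    ext
    · simp
    · simpa using (ZMod.natCast_eq_one_iff_odd).2 hodd
  classical
  let T : Finset (ZMod p × ZMod 2) := Finset.univ.filter fun x => e.symm x ∈ S
  have hT : ∀ x, x ∈ T ↔ e.symm x ∈ S := fun x => by simp [T]
  have hT' : ∀ x, e x ∈ T ↔ x ∈ S := fun x => by simp [hT]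
  obtain ⟨α, β, h, hne⟩ := exists_perm_ne_of_isNontriviallyUnstable hSneg hS0 hX
  let π : ZMod (2 * p) →+ ZMod 2 := (AddMonoidHom.snd _ _).comp e.toAddEquiv.toAddMonoidHom
  have hπ : Function.Surjective π := Prod.snd_surjective.comp e.surjective
  obtain ⟨s, hs, hs1⟩ := exists_mem_apply_eq_one hSneg hS0 hX.1 π hπ
  obtain ⟨r, hr, hr0⟩ := exists_mem_apply_eq_zero hSneg hS0 hX.2.1 π
  have hmain := eq_or_exists_unit (T := T) (α := (e.toEquiv.permCongr α))
    (β := (e.toEquiv.permCongr β)) hp2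
    (fun x y => by
      have := h (e.symm x) (e.symm y)
      rw [← map_sub, ← hT, ← hT', map_sub] at this
      exact this)
    (fun x hx => by rw [hT, map_neg]; exact hSneg _ ((hT x).1 hx))
    (by rw [hT, ← Prod.zero_eq_mk, map_zero]; exact hS0) ⟨e r, (hT' r).2 hr, hr0⟩ ⟨e s, (hT' s).2 hs, hs1⟩
    (fun H => by
      -- If the layers coincided, `T` would be invariant under `(0, 1) = e p`, making `0` and `p`
      -- twins.
      have H' : ∀ x, x ∈ T ↔ x + (0, 1) ∈ T := by
        rintro ⟨u, i⟩
        rcases zmod_two_eq_zero_or_one i with rfl | rfl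
        · simpa using H u
        · simpa [show (1 : ZMod 2) + 1 = 0 from rfl] using (H u).symm
      have h1 : (p : ZMod (2 * p)) = 0 := hX.2.2.1 _ _ <| by
        ext w
        rw [SimpleGraph.mem_neighborSet, SimpleGraph.mem_neighborSet,
          addCayley_adj_iff hSneg hS0, addCayley_adj_iff hSneg hS0, ← hT', ← hT', H' (e (0 - w)),
          ← hep, ← map_add]
        simp [sub_eq_add_neg, add_comm]
      rw [h1, map_zero] at hep
      exact zero_ne_one (congrArg Prod.snd hep))
  rcases hmain with heq | ⟨m, hm⟩
  · exact absurd (e.toEquiv.permCongr.injective heq) hne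
  -- The unit corresponding to `(m, 1)`; then `x ↦ p + m' * x` becomes `(u, i) ↦ (m * u, i + 1)`.
  let m' : (ZMod (2 * p))ˣ := Units.map e.symm.toMonoidHom (MulEquiv.prodUnits.symm (m, 1))
  have hm' : e m' = ((m : ZMod p), 1) := e.apply_symm_apply _
  refine hasWilsonTypeC4_of_forall m' fun x => ?_
  rw [Nat.mul_div_cancel_left p two_pos, ← hT', ← hT', map_add, map_mul, hep, hm']
  have := hm (e x).1 (e x).2
  rw [add_comm] at this
  convert this using 2
  ext <;> simp
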